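/- For finite sets $A,B$ of positive integers, a \emph{coprime mapping} from $A$ to $B$ is a bijection $\varphi:A\to B$ such that $\gcd(a,\varphi(a))=1$ for every $a\in A$. For each positive integer $n$, let $f(n)$ be the smallest non-negative integer such that for every integer $m\ge 0$ with $2m\ge f(n)$ there is a coprime mapping between every pair of intervals (sets of consecutive integers) $A,B\subseteq[n]=\{1,\dots,n\}$ with $|A|=|B|=2m$. Then $$f(n)=\exp\bigl(O((\log\log n)^2)\bigr)\qquad(n\to\infty),$$ that is, there is a function $g:\mathbb{N}\to\mathbb{R}$ with $g(n)=O((\log\log n)^2)$ as $n\to\infty$ such that $f(n)=\exp(g(n))$ for all sufficiently large $n$. -/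

import Mathlib

open Filter Asymptotics

/-- `φ` restricts to a coprime mapping from `A` to `B`: a bijection from `A` onto `B` such that
`a` and `φ a` are coprime for every `a ∈ A`. -/
def IsCoprimeMapping (A B : Finset ℕ) (φ : ℕ → ℕ) : Prop :=
  Set.BijOn φ (A : Set ℕ) (B : Set ℕ) ∧ ∀ a ∈ A, Nat.Coprime a (φ a)

/-- A (finite, possibly empty) interval, that is, a set of consecutive natural numbers. -/
def IsIntervalSet (A : Finset ℕ) : Prop :=
  ∃ a b : ℕ, A = Finset.Icc a b

/-- For every `m` with `2 * m ≥ k`, there is a coprime mapping between every pair of intervals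
`A, B ⊆ [n] = {1, …, n}` of cardinality `2 * m`. -/
def CoprimeMappingsFrom (n k : ℕ) : Prop :=
  ∀ m : ℕ, k ≤ 2 * m → ∀ A B : Finset ℕ, IsIntervalSet A → IsIntervalSet B →
    A ⊆ Finset.Icc 1 n → B ⊆ Finset.Icc 1 n → A.card = 2 * m → B.card = 2 * m →
      ∃ φ : ℕ → ℕ, IsCoprimeMapping A B φ

/-- The smallest threshold `k` such that `CoprimeMappingsFrom n k` holds. -/
noncomputable def coprimeThreshold (n : ℕ) : ℕ :=
  sInf {k : ℕ | CoprimeMappingsFrom n k}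

/-- The threshold is a genuine minimum: the defining set is never empty. -/
theorem coprimeThreshold_isLeast (n : ℕ) :
    IsLeast {k : ℕ | CoprimeMappingsFrom n k} (coprimeThreshold n) := by
  have hne : {k : ℕ | CoprimeMappingsFrom n k}.Nonempty := by
    refine ⟨n + 1, ?_⟩
    intro m hm A B _ _ hA _ hcA _
    have h := Finset.card_le_card hA
    simp only [Nat.card_Icc] at h
    omega
  exact ⟨Nat.sInf_mem hne, fun k hk => Nat.sInf_le hk⟩

/-! Split both intervals into parity classes and pair classes of opposite parity: then 2 never
divides both members of a pair, so only odd primes obstruct. Each class is a progression of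
difference two and length `m`, to be matched by Hall's theorem. A failure gives index sets `S`, `T`
without coprime pairs and with `|S| + |T| > m`; by symmetry `|T| ≥ m / 2`. Put `u = m - |T|`, so `u
≤ m / 2` and `u < |S|`.

For a term `s` indexed by `S`, let `H(s)` be the product of `p / (p - 1)` over the odd primes
dividing `s`. Brun's sieve finds nearly `m / H(s)` terms of the other progression sharing no odd
prime with `s`. All lie outside `T`, so `H(s) ≥ 0.998 m / u` (`le_oddRatio_mul_sub_card`). But the
mean of `H ^ 2` over the progression is at most 1.88 (`sum_oddRatio_sq_le`), whence `|S| ≤ (1.88 /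
0.998 ^ 2) u ^ 2 / m < u`, a contradiction. The second moment is essential: its constant is below 2,
which `u ≤ m / 2` can absorb, while the mean of `H` exceeds 1 and would give only `|S| ≤ C u` with
`C > 1`.

With `w = log₂ n`, a sieve of depth `k` needs `2 ^ k` of order `w ^ 3` and `m` of order `w ^ (k +
1)`. So `k` of order `log log n` suffices, and `m = exp(O((log log n) ^ 2))`. -/

/-! ### Elementary counts and products -/

theorem exists_dvd_add_two_mul_iff {d : ℕ} (hd : Odd d) (c : ℕ) :
    ∃ r : ℕ, ∀ i : ℕ, d ∣ c + 2 * i ↔ i ≡ r [MOD d] := by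
  have hcop : Nat.Coprime 2 d := (Nat.coprime_two_left).2 hd
  have hd0 : 0 < d := hd.pos
  obtain ⟨r, hr⟩ : ∃ r : ℕ, d ∣ c + 2 * r := by
    obtain ⟨e, rfl⟩ := hd
    -- With `d = 2e + 1`, `c + 2ce = cd`.
    exact ⟨c * e, ⟨c, by ring⟩⟩
  refine ⟨r, fun i => ?_⟩
  constructor
  · intro hi
    have h : c + 2 * i ≡ c + 2 * r [MOD d] :=
      ((Nat.modEq_zero_iff_dvd).2 hi).trans ((Nat.modEq_zero_iff_dvd).2 hr).symm
    exact Nat.ModEq.cancel_left_of_coprime (by rw [Nat.gcd_comm]; exact hcop)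
      (Nat.ModEq.add_left_cancel' c h)
  · intro hi
    exact (Nat.modEq_zero_iff_dvd).1
      (((hi.mul_left 2).add_left c).trans ((Nat.modEq_zero_iff_dvd).2 hr))

/-- A progression of difference two and length `m` has `m / d` multiples of an odd `d`, up to an
error of at most one. -/
theorem abs_card_filter_dvd_sub_le {d : ℕ} (hd : Odd d) (c m : ℕ) :
    |(((Finset.range m).filter fun i => d ∣ c + 2 * i).card : ℝ) - (m : ℝ) / d| ≤ 1 := by
  obtain ⟨r, hr⟩ := exists_dvd_add_two_mul_iff hd c
  have hd0 : 0 < d := hd.pos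
  have hcard : ((Finset.range m).filter fun i => d ∣ c + 2 * i).card
      = m / d + if r % d < m % d then 1 else 0 := by
    rw [← Nat.count_modEq_card m hd0 r, Nat.count_eq_card_filter_range]
    congr 1
    exact Finset.filter_congr fun i _ => hr i
  have hdR : (0 : ℝ) < d := by exact_mod_cast hd0
  have hm : (m : ℝ) / d = ((m / d : ℕ) : ℝ) + ((m % d : ℕ) : ℝ) / d := by
    have : (m : ℝ) = d * ((m / d : ℕ) : ℝ) + ((m % d : ℕ) : ℝ) := by
      exact_mod_cast (Nat.div_add_mod m d).symm
    field_simp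
    linarith
  have h0 : 0 ≤ ((m % d : ℕ) : ℝ) / d := by positivity
  have h1 : ((m % d : ℕ) : ℝ) / d ≤ 1 := by
    rw [div_le_one hdR]
    exact_mod_cast (Nat.mod_lt m hd0).le
  rw [hcard, hm, abs_le]
  push_cast
  split_ifs <;> constructor <;> linarith

/-- The `i`-th smallest element of `Q` is at least `z + i`, so the product is dominated by the
telescoping product of `(z + i) / (z + i - 1)`. Primality plays no role. -/
theorem prod_div_sub_one_le {z : ℕ} (hz : 0 < z) (Q : Finset ℕ) (hQ : ∀ p ∈ Q, z < p) :
    ∏ p ∈ Q, ((p : ℝ) / (p - 1)) ≤ ((z : ℝ) + Q.card) / z := by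
  induction Q using Finset.induction_on_max with
  | empty => simp [hz.ne']
  | insert a s ha ih =>
    have has : a ∉ s := fun h => lt_irrefl a (ha a h)
    have hzR : (0 : ℝ) < z := by exact_mod_cast hz
    have hsub : s ⊆ Finset.Ioo z a := fun x hx =>
      Finset.mem_Ioo.2 ⟨hQ x (Finset.mem_insert_of_mem hx), ha x hx⟩
    have hcard := Finset.card_le_card hsub
    rw [Nat.card_Ioo] at hcard
    have hza := hQ a (Finset.mem_insert_self a s)
    have hle : z + s.card + 1 ≤ a := by omega
    have hleR : (z : ℝ) + s.card + 1 ≤ a := by exact_mod_cast hle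
    have hs0 : (0 : ℝ) ≤ s.card := by positivity
    have hfac : (a : ℝ) / (a - 1) ≤ ((z : ℝ) + s.card + 1) / (z + s.card) := by
      rw [div_le_div_iff₀ (by linarith) (by linarith)]
      linarith
    rw [Finset.prod_insert has, Finset.card_insert_of_notMem has]
    calc (a : ℝ) / (a - 1) * ∏ p ∈ s, ((p : ℝ) / (p - 1))
        ≤ ((z : ℝ) + s.card + 1) / (z + s.card) * (((z : ℝ) + s.card) / z) := by
          refine mul_le_mul hfac (ih fun p hp => hQ p (Finset.mem_insert_of_mem hp)) ?_ (by positivity)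
          refine Finset.prod_nonneg fun p hp => ?_
          have : (1 : ℝ) ≤ p := by
            exact_mod_cast (by have := hQ p (Finset.mem_insert_of_mem hp); omega : 1 ≤ p)
          exact div_nonneg (by linarith) (by linarith)
      _ = _ := by
          push_cast
          field_simp
          ring

theorem card_primeFactors_le_log {s n : ℕ} (hs : s ≠ 0) (hsn : s ≤ n) :
    s.primeFactors.card ≤ Nat.log 2 n := by
  apply Nat.le_log_of_pow_le (by norm_num)
  calc 2 ^ s.primeFactors.card ≤ ∏ p ∈ s.primeFactors, p := by
        rw [← Finset.prod_const]
        exact Finset.prod_le_prod' fun p hp => (Nat.prime_of_mem_primeFactors hp).two_le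
    _ ≤ s := Nat.le_of_dvd (Nat.pos_of_ne_zero hs) (Nat.prod_primeFactors_dvd s)
    _ ≤ n := hsn

/-! ### Brun's pure sieve -/

/-- The Bonferroni inequality for inclusion-exclusion truncated after an odd number of steps. -/
theorem sum_powerset_card_le_neg_one_pow_le {α : Type*} [DecidableEq α] (V : Finset α) {k : ℕ}
    (hk : Odd k) :
    ∑ U ∈ V.powerset with U.card ≤ k, (-1 : ℝ) ^ U.card ≤ if V = ∅ then 1 else 0 := by
  have key : ∑ U ∈ V.powerset with U.card ≤ k, (-1 : ℤ) ^ U.card ≤ if V = ∅ then 1 else 0 := by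
    rw [Finset.sum_filter,
      Finset.sum_powerset_apply_card (fun j => if j ≤ k then (-1 : ℤ) ^ j else 0)]
    rcases Finset.eq_empty_or_nonempty V with rfl | hV
    · simp
    rw [if_neg hV.ne_empty]
    obtain ⟨v, hv⟩ : ∃ v, V.card = v + 1 := ⟨V.card - 1, by have := hV.card_pos; omega⟩
    have hsum : ∑ j ∈ Finset.range (V.card + 1), V.card.choose j • (if j ≤ k then (-1 : ℤ) ^ j else 0)
        = ∑ j ∈ Finset.range (k + 1), ((-1) ^ j * (V.card.choose j) : ℤ) := by
      have h1 : ∀ N, V.card ≤ N → k ≤ N →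
          ∑ j ∈ Finset.range (V.card + 1), V.card.choose j • (if j ≤ k then (-1 : ℤ) ^ j else 0)
          = ∑ j ∈ Finset.range (N + 1), V.card.choose j • (if j ≤ k then (-1 : ℤ) ^ j else 0) := by
        intro N hN _
        refine Finset.sum_subset (Finset.range_mono (by omega)) fun j _ hj => ?_
        rw [Finset.mem_range] at hj
        rw [Nat.choose_eq_zero_of_lt (by omega), zero_smul]
      rw [h1 (V.card + k) (by omega) (by omega)]
      symm
      refine (Finset.sum_congr rfl fun j hj => ?_).trans
        (Finset.sum_subset (Finset.range_mono (by omega : k + 1 ≤ V.card + k + 1)) fun j _ hj => ?_)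
      · rw [Finset.mem_range] at hj
        rw [if_pos (by omega), nsmul_eq_mul, mul_comm]
      · rw [Finset.mem_range] at hj
        rw [if_neg (by omega), smul_zero]
    -- The truncated alternating sum is `(-1) ^ k` times a binomial coefficient, hence nonpositive
    -- for odd `k`.
    rw [hsum, hv, Int.alternating_sum_range_choose_eq_choose, hk.neg_one_pow]
    simp
  have := (Int.cast_le (R := ℝ)).2 key
  push_cast at this
  exact this

/-- Termwise comparison with the binomial expansion: `C(|Q|, j) ≤ |Q| ^ j ≤ |Q| ^ j C(k, j)` for `j
≤ k`. -/
theorem card_powerset_filter_card_le {α : Type*} [DecidableEq α] (Q : Finset α) (k : ℕ) :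
    (Q.powerset.filter fun U => U.card ≤ k).card ≤ (Q.card + 1) ^ k := by
  have h1 : Q.powerset.filter (fun U => U.card ≤ k)
      = (Finset.range (k + 1)).biUnion fun j => Q.powersetCard j := by
    ext U
    simp only [Finset.mem_filter, Finset.mem_powerset, Finset.mem_biUnion, Finset.mem_range,
      Finset.mem_powersetCard]
    constructor
    · rintro ⟨h, h'⟩
      exact ⟨U.card, by omega, h, rfl⟩
    · rintro ⟨j, hj, h, h'⟩
      exact ⟨h, by omega⟩
  rw [h1, add_pow]
  refine Finset.card_biUnion_le.trans (Finset.sum_le_sum fun j hj => ?_)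
  rw [Finset.card_powersetCard, one_pow, mul_one]
  rw [Finset.mem_range] at hj
  exact (Nat.choose_le_pow _ _).trans
    (Nat.le_mul_of_pos_right _ (Nat.choose_pos (by omega)))

theorem odd_prod_of_prime {U : Finset ℕ} (hU : ∀ p ∈ U, p.Prime ∧ p ≠ 2) : Odd (∏ p ∈ U, p) :=
  Finset.prod_induction _ Odd (fun _ _ => Odd.mul) odd_one fun p hp =>
    (hU p hp).1.odd_of_ne_two (hU p hp).2

theorem forall_dvd_iff_prod_dvd {U : Finset ℕ} (hU : ∀ p ∈ U, p.Prime) (b : ℕ) :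
    (∀ p ∈ U, p ∣ b) ↔ ∏ p ∈ U, p ∣ b :=
  ⟨fun h => Finset.prod_primes_dvd b (fun p hp => (hU p hp).prime) h,
    fun h _ hp => (Finset.dvd_prod_of_mem _ hp).trans h⟩

/-- Brun's pure sieve with Rankin's bound for the discarded terms. -/
theorem le_card_filter_forall_not_dvd {Q : Finset ℕ} (hQ : ∀ p ∈ Q, p.Prime ∧ p ≠ 2) (c m : ℕ)
    {k : ℕ} (hk : Odd k) :
    (m : ℝ) * (∏ p ∈ Q, (1 - 1 / (p : ℝ)) - (∏ p ∈ Q, ((p : ℝ) / (p - 1))) ^ 2 / 2 ^ (k + 1))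
        - ((Q.card : ℝ) + 1) ^ k ≤
      (((Finset.range m).filter fun i => ∀ p ∈ Q, ¬ p ∣ c + 2 * i).card : ℝ) := by
  set D : Finset ℕ → ℕ := fun U => ((Finset.range m).filter fun i => ∏ p ∈ U, p ∣ c + 2 * i).card
    with hD
  set F := Q.powerset.filter fun U => U.card ≤ k with hF
  have hprime : ∀ U ∈ Q.powerset, ∀ p ∈ U, p.Prime ∧ p ≠ 2 := fun U hU p hp =>
    hQ p (Finset.mem_powerset.1 hU hp)
  have hcount : ∑ U ∈ F, (-1 : ℝ) ^ U.card * D U ≤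
      (((Finset.range m).filter fun i => ∀ p ∈ Q, ¬ p ∣ c + 2 * i).card : ℝ) := by
    have h1 : ∀ i, ∑ U ∈ F, (if ∏ p ∈ U, p ∣ c + 2 * i then (-1 : ℝ) ^ U.card else 0)
        ≤ if ∀ p ∈ Q, ¬ p ∣ c + 2 * i then 1 else 0 := by
      intro i
      have := sum_powerset_card_le_neg_one_pow_le (Q.filter fun p => p ∣ c + 2 * i) hk
      simp only [Finset.filter_eq_empty_iff] at this
      refine le_trans (le_of_eq ?_) this
      rw [← Finset.sum_filter]
      refine Finset.sum_congr ?_ fun _ _ => rfl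
      ext U
      simp only [hF, Finset.mem_filter, Finset.mem_powerset]
      constructor
      · rintro ⟨⟨h, h'⟩, h''⟩
        refine ⟨fun p hp => Finset.mem_filter.2 ⟨h hp, ?_⟩, h'⟩
        exact (Finset.dvd_prod_of_mem _ hp).trans h''
      · rintro ⟨h, h'⟩
        have hUQ : U ⊆ Q := h.trans (Finset.filter_subset _ _)
        refine ⟨⟨hUQ, h'⟩, (forall_dvd_iff_prod_dvd (fun p hp => (hQ p (hUQ hp)).1) _).1 ?_⟩
        exact fun p hp => (Finset.mem_filter.1 (h hp)).2
    have h2 := Finset.sum_le_sum fun i (_ : i ∈ Finset.range m) => h1 i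
    rw [Finset.sum_boole] at h2
    refine le_trans (le_of_eq ?_) h2
    rw [Finset.sum_comm]
    refine Finset.sum_congr rfl fun U _ => ?_
    rw [← Finset.sum_filter, Finset.sum_const, nsmul_eq_mul, mul_comm]
  have hmain : ∑ U ∈ F, ((-1 : ℝ) ^ U.card * (m / (∏ p ∈ U, (p : ℝ))) - 1)
      ≤ ∑ U ∈ F, (-1 : ℝ) ^ U.card * D U := by
    refine Finset.sum_le_sum fun U hU => ?_
    have h := abs_card_filter_dvd_sub_le
      (odd_prod_of_prime (hprime U (Finset.mem_filter.1 hU).1)) c m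
    push_cast at h
    rw [abs_le] at h
    have hDU : (D U : ℝ) = (((Finset.range m).filter fun i => ∏ p ∈ U, p ∣ c + 2 * i).card : ℝ) :=
      rfl
    rw [← hDU] at h
    rcases neg_one_pow_eq_or ℝ U.card with h' | h' <;> (rw [h']; linarith [h.1, h.2])
  have hF_card : (F.card : ℝ) ≤ ((Q.card : ℝ) + 1) ^ k := by
    exact_mod_cast card_powerset_filter_card_le Q k
  have hexp : ∏ p ∈ Q, (1 - 1 / (p : ℝ))
      = ∑ U ∈ Q.powerset, (-1 : ℝ) ^ U.card * (1 / ∏ p ∈ U, (p : ℝ)) := by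
    simp only [sub_eq_add_neg]
    rw [Finset.prod_one_add]
    refine Finset.sum_congr rfl fun U _ => ?_
    rw [Finset.prod_neg, one_div, ← Finset.prod_inv_distrib]
    simp only [one_div]
  -- Rankin's trick: a discarded `U` has `|U| ≥ k + 1`, so the weight `2 ^ |U| / 2 ^ (k + 1)` is at
  -- least 1. The weighted sum over all subsets factors as an Euler product.
  have htail : ∑ U ∈ Q.powerset with ¬ U.card ≤ k, (-1 : ℝ) ^ U.card * (1 / ∏ p ∈ U, (p : ℝ))
      ≤ (∏ p ∈ Q, ((p : ℝ) / (p - 1))) ^ 2 / 2 ^ (k + 1) := by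
    calc ∑ U ∈ Q.powerset with ¬ U.card ≤ k, (-1 : ℝ) ^ U.card * (1 / ∏ p ∈ U, (p : ℝ))
        ≤ ∑ U ∈ Q.powerset with ¬ U.card ≤ k, (∏ p ∈ U, (2 / (p : ℝ))) / 2 ^ (k + 1) := by
          refine Finset.sum_le_sum fun U hU => ?_
          rw [Finset.mem_filter] at hU
          have hpos : 0 ≤ 1 / ∏ p ∈ U, (p : ℝ) := by positivity
          have hpow : (2 : ℝ) ^ (k + 1) ≤ 2 ^ U.card :=
            pow_le_pow_right₀ (by norm_num) (by omega)
          have hone : 1 ≤ (2 : ℝ) ^ U.card / 2 ^ (k + 1) := by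
            rwa [one_le_div (by positivity)]
          rw [Finset.prod_div_distrib, Finset.prod_const]
          calc (-1 : ℝ) ^ U.card * (1 / ∏ p ∈ U, (p : ℝ)) ≤ 1 * (1 / ∏ p ∈ U, (p : ℝ)) := by
                refine mul_le_mul_of_nonneg_right ?_ hpos
                rcases neg_one_pow_eq_or ℝ U.card with h' | h' <;> norm_num [h']
            _ ≤ (2 : ℝ) ^ U.card / 2 ^ (k + 1) * (1 / ∏ p ∈ U, (p : ℝ)) :=
                mul_le_mul_of_nonneg_right hone hpos
            _ = _ := by ring
      _ ≤ ∑ U ∈ Q.powerset, (∏ p ∈ U, (2 / (p : ℝ))) / 2 ^ (k + 1) := by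
          refine Finset.sum_le_sum_of_subset_of_nonneg (Finset.filter_subset _ _) fun U _ _ => ?_
          positivity
      _ = (∏ p ∈ Q, (1 + 2 / (p : ℝ))) / 2 ^ (k + 1) := by
          rw [← Finset.sum_div, Finset.prod_one_add]
      _ ≤ _ := by
          refine div_le_div_of_nonneg_right ?_ (by positivity)
          rw [← Finset.prod_pow]
          refine Finset.prod_le_prod (fun _ _ => by positivity) fun p hp => ?_
          have hp2 : (2 : ℝ) ≤ p := by exact_mod_cast (hQ p hp).1.two_le
          rw [div_pow, le_div_iff₀ (by nlinarith)]
          have : (1 + 2 / (p : ℝ)) * ((p : ℝ) - 1) ^ 2 = p ^ 2 - 3 + 2 / p := by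
            field_simp
            ring
          rw [this]
          have : 2 / (p : ℝ) ≤ 1 := by rw [div_le_one (by linarith)]; exact hp2
          linarith
  have hsplit := Finset.sum_filter_add_sum_filter_not Q.powerset (fun U => U.card ≤ k)
    fun U => (-1 : ℝ) ^ U.card * (1 / ∏ p ∈ U, (p : ℝ))
  rw [← hexp] at hsplit
  have hmain' : ∑ U ∈ F, ((-1 : ℝ) ^ U.card * (m / (∏ p ∈ U, (p : ℝ))) - 1)
      = m * ∑ U ∈ F, (-1 : ℝ) ^ U.card * (1 / ∏ p ∈ U, (p : ℝ)) - F.card := by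
    rw [Finset.sum_sub_distrib, Finset.mul_sum, Finset.sum_const, nsmul_eq_mul, mul_one]
    congr 1
    exact Finset.sum_congr rfl fun U _ => by ring
  have hle : ∏ p ∈ Q, (1 - 1 / (p : ℝ)) - (∏ p ∈ Q, ((p : ℝ) / (p - 1))) ^ 2 / 2 ^ (k + 1)
      ≤ ∑ U ∈ F, (-1 : ℝ) ^ U.card * (1 / ∏ p ∈ U, (p : ℝ)) := by linarith
  have := mul_le_mul_of_nonneg_left hle (Nat.cast_nonneg (α := ℝ) m)
  linarith

/-! ### Second moment of the inverse density -/

/-- The odd primes up to `z`. -/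
def oddPrimesUpTo (z : ℕ) : Finset ℕ :=
  (Finset.range (z + 1)).filter fun p => p.Prime ∧ p ≠ 2

/-- The odd prime factors of `s`. -/
def oddPrimeFactors (s : ℕ) : Finset ℕ :=
  s.primeFactors.erase 2

/-- The inverse density of the integers that share no odd prime factor with `s`. -/
noncomputable def oddRatio (s : ℕ) : ℝ :=
  ∏ p ∈ oddPrimeFactors s, ((p : ℝ) / (p - 1))

theorem prime_of_mem_oddPrimeFactors {s p : ℕ} (hp : p ∈ oddPrimeFactors s) :
    p.Prime ∧ p ≠ 2 :=
  ⟨Nat.prime_of_mem_primeFactors (Finset.mem_of_mem_erase hp), Finset.ne_of_mem_erase hp⟩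

theorem prime_of_mem_oddPrimesUpTo {z p : ℕ} (hp : p ∈ oddPrimesUpTo z) : p.Prime ∧ p ≠ 2 :=
  (Finset.mem_filter.1 hp).2

theorem card_oddPrimeFactors_le_log {s n : ℕ} (hs : s ≠ 0) (hsn : s ≤ n) :
    (oddPrimeFactors s).card ≤ Nat.log 2 n :=
  (Finset.card_le_card (Finset.erase_subset _ _)).trans (card_primeFactors_le_log hs hsn)

theorem one_le_div_sub_one {p : ℕ} (hp : 2 ≤ p) : (1 : ℝ) ≤ (p : ℝ) / (p - 1) := by
  have : (2 : ℝ) ≤ p := by exact_mod_cast hp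
  rw [one_le_div (by linarith)]
  linarith

theorem one_le_oddRatio (s : ℕ) : 1 ≤ oddRatio s :=
  Finset.prod_induction _ (fun x : ℝ => 1 ≤ x)
    (fun _ _ ha hb => one_le_mul_of_one_le_of_one_le ha hb) le_rfl fun _ hp =>
    one_le_div_sub_one (prime_of_mem_oddPrimeFactors hp).1.two_le

theorem oddRatio_le {s n : ℕ} (hs : s ≠ 0) (hsn : s ≤ n) : oddRatio s ≤ Nat.log 2 n + 1 := by
  have h := prod_div_sub_one_le one_pos (oddPrimeFactors s)
    fun p hp => (prime_of_mem_oddPrimeFactors hp).1.one_lt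
  have hc : ((oddPrimeFactors s).card : ℝ) ≤ Nat.log 2 n := by
    exact_mod_cast card_oddPrimeFactors_le_log hs hsn
  unfold oddRatio
  push_cast at h
  rw [div_one] at h
  linarith

theorem prod_one_sub_inv_eq (s : ℕ) :
    ∏ p ∈ oddPrimeFactors s, (1 - 1 / (p : ℝ)) = 1 / oddRatio s := by
  unfold oddRatio
  rw [one_div, ← Finset.prod_inv_distrib]
  refine Finset.prod_congr rfl fun p hp => ?_
  have : (0 : ℝ) < p := by exact_mod_cast (prime_of_mem_oddPrimeFactors hp).1.pos
  rw [inv_div]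
  field_simp

theorem div_sub_one_sq_eq {p : ℕ} (hp : 2 ≤ p) :
    ((p : ℝ) / (p - 1)) ^ 2 = 1 + (2 * p - 1) / ((p : ℝ) - 1) ^ 2 := by
  have : (2 : ℝ) ≤ p := by exact_mod_cast hp
  have h : (p : ℝ) - 1 ≠ 0 := by linarith
  field_simp
  ring

/-- Write each square as `1 + g p`, expand over sets of primes and exchange the sums. A set with
product `d` is counted at most `m / d + 1` times: `m / d` gives the main term, 1 the error. -/
theorem sum_prod_dvd_sq_le (c m z : ℕ) :
    ∑ i ∈ Finset.range m,
        ∏ p ∈ oddPrimesUpTo z with p ∣ c + 2 * i, ((p : ℝ) / (p - 1)) ^ 2 ≤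
      (m : ℝ) * ∏ p ∈ oddPrimesUpTo z, (1 + (2 * p - 1) / ((p : ℝ) * (p - 1) ^ 2)) +
        ∏ p ∈ oddPrimesUpTo z, ((p : ℝ) / (p - 1)) ^ 2 := by
  set P := oddPrimesUpTo z with hP
  have hPp : ∀ p ∈ P, p.Prime ∧ p ≠ 2 := fun p hp => prime_of_mem_oddPrimesUpTo hp
  set g : ℕ → ℝ := fun p => (2 * p - 1) / ((p : ℝ) - 1) ^ 2 with hg
  have hg0 : ∀ p ∈ P, 0 ≤ g p := fun p hp => by
    have : (2 : ℝ) ≤ p := by exact_mod_cast (hPp p hp).1.two_le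
    exact div_nonneg (by linarith) (sq_nonneg _)
  have h1 : ∀ i, ∏ p ∈ P with p ∣ c + 2 * i, ((p : ℝ) / (p - 1)) ^ 2
      = ∑ U ∈ P.powerset, if ∏ p ∈ U, p ∣ c + 2 * i then ∏ p ∈ U, g p else 0 := by
    intro i
    rw [Finset.prod_congr rfl (fun p hp =>
      div_sub_one_sq_eq (hPp p (Finset.mem_filter.1 hp).1).1.two_le), Finset.prod_one_add,
      ← Finset.sum_filter]
    refine Finset.sum_congr ?_ fun _ _ => rfl
    ext U
    simp only [Finset.mem_filter, Finset.mem_powerset]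
    constructor
    · intro h
      have hUP : U ⊆ P := h.trans (Finset.filter_subset _ _)
      refine ⟨hUP, (forall_dvd_iff_prod_dvd (fun p hp => (hPp p (hUP hp)).1) _).1 ?_⟩
      exact fun p hp => (Finset.mem_filter.1 (h hp)).2
    · rintro ⟨h, h'⟩ p hp
      exact Finset.mem_filter.2 ⟨h hp, (Finset.dvd_prod_of_mem _ hp).trans h'⟩
  rw [Finset.sum_congr rfl fun i _ => h1 i, Finset.sum_comm,
    Finset.prod_congr rfl (fun p hp => div_sub_one_sq_eq (hPp p hp).1.two_le),
    Finset.prod_one_add, Finset.prod_one_add, Finset.mul_sum, ← Finset.sum_add_distrib]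
  refine Finset.sum_le_sum fun U hU => ?_
  have hUP := Finset.mem_powerset.1 hU
  have h := abs_card_filter_dvd_sub_le (odd_prod_of_prime fun p hp => hPp p (hUP hp)) c m
  rw [abs_le] at h
  have hG : 0 ≤ ∏ p ∈ U, g p := Finset.prod_nonneg fun p hp => hg0 p (hUP hp)
  rw [← Finset.sum_filter, Finset.sum_const, nsmul_eq_mul]
  have h2 : ∏ p ∈ U, (2 * (p : ℝ) - 1) / ((p : ℝ) * (p - 1) ^ 2)
      = (∏ p ∈ U, g p) / ((∏ p ∈ U, p : ℕ) : ℝ) := by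
    push_cast
    rw [← Finset.prod_div_distrib]
    refine Finset.prod_congr rfl fun p _ => ?_
    rw [hg]
    simp only
    rw [div_div, mul_comm (p : ℝ)]
  rw [h2]
  calc _ ≤ ((m : ℝ) / ((∏ p ∈ U, p : ℕ) : ℝ) + 1) * ∏ p ∈ U, g p :=
        mul_le_mul_of_nonneg_right (by linarith [h.2]) hG
    _ = _ := by
        simp only [hg]
        ring

/-- The factor `1 - 1 / (2 (N + 4) + 1)` makes the induction close: every odd number from 11 on is
treated as a prime, and its factor is absorbed by the increase of this one. The constant 1.865 is
fixed by the exact product over 3, 5, 7. -/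
theorem prod_oddPrimesUpTo_odd_le (N : ℕ) :
    ∏ p ∈ oddPrimesUpTo (2 * (N + 4) + 1), (1 + (2 * p - 1) / ((p : ℝ) * (p - 1) ^ 2)) ≤
      (1865 / 1000) * (1 - 1 / (2 * ((N : ℝ) + 4) + 1)) := by
  induction N with
  | zero =>
    have : oddPrimesUpTo (2 * (0 + 4) + 1) = {3, 5, 7} := by decide
    rw [this]
    norm_num
  | succ N ih =>
    have hset : oddPrimesUpTo (2 * (N + 1 + 4) + 1) ⊆
        insert (2 * (N + 1 + 4) + 1) (oddPrimesUpTo (2 * (N + 4) + 1)) := by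
      intro p hp
      simp only [oddPrimesUpTo, Finset.mem_filter, Finset.mem_range, Finset.mem_insert] at hp ⊢
      obtain ⟨h1, h2, h3⟩ := hp
      obtain ⟨e, he⟩ := h2.odd_of_ne_two h3
      by_cases h : p = 2 * (N + 1 + 4) + 1
      · exact Or.inl h
      · exact Or.inr ⟨by omega, h2, h3⟩
    have hnot : 2 * (N + 1 + 4) + 1 ∉ oddPrimesUpTo (2 * (N + 4) + 1) := by
      simp only [oddPrimesUpTo, Finset.mem_filter, Finset.mem_range]
      omega
    have hfac : ∀ p : ℕ, 2 ≤ p → (1 : ℝ) ≤ 1 + (2 * p - 1) / ((p : ℝ) * (p - 1) ^ 2) := by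
      intro p hp
      have : (2 : ℝ) ≤ p := by exact_mod_cast hp
      have : 0 ≤ (2 * (p : ℝ) - 1) / ((p : ℝ) * (p - 1) ^ 2) :=
        div_nonneg (by linarith) (by positivity)
      linarith
    have hge : ∀ p ∈ insert (2 * (N + 1 + 4) + 1) (oddPrimesUpTo (2 * (N + 4) + 1)), 2 ≤ p := by
      intro p hp
      rcases Finset.mem_insert.1 hp with rfl | hp
      · omega
      · exact (prime_of_mem_oddPrimesUpTo hp).1.two_le
    refine (Finset.prod_le_prod_of_subset_of_one_le hset
      (fun p hp => zero_le_one.trans (hfac p (hge p (hset hp)))) fun p hp _ => hfac p (hge p hp)).trans ?_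
    rw [Finset.prod_insert hnot]
    refine (mul_le_mul_of_nonneg_left ih
      (zero_le_one.trans (hfac _ (by omega)))).trans ?_
    push_cast
    have hx : (0 : ℝ) ≤ N := Nat.cast_nonneg N
    have e1 : (1 + (2 * (2 * ((N : ℝ) + 1 + 4) + 1) - 1) /
        ((2 * ((N : ℝ) + 1 + 4) + 1) * (2 * ((N : ℝ) + 1 + 4) + 1 - 1) ^ 2)) ≤
        1 + 1 / (2 * ((N : ℝ) + 5) ^ 2) := by
      have e0 : 2 * ((N : ℝ) + 1 + 4) + 1 - 1 = 2 * (N + 5) := by ring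
      rw [e0]
      gcongr 1 + ?_
      rw [div_le_div_iff₀ (by positivity) (by positivity)]
      nlinarith [mul_nonneg hx hx, mul_nonneg hx (mul_nonneg hx hx)]
    have e2 : (1 + 1 / (2 * ((N : ℝ) + 5) ^ 2)) * (1 - 1 / (2 * ((N : ℝ) + 4) + 1)) ≤
        1 - 1 / (2 * ((N : ℝ) + 1 + 4) + 1) := by
      have : (1 - 1 / (2 * ((N : ℝ) + 1 + 4) + 1)) -
          (1 + 1 / (2 * ((N : ℝ) + 5) ^ 2)) * (1 - 1 / (2 * ((N : ℝ) + 4) + 1))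
          = (2 * N + 12) / (2 * ((N : ℝ) + 5) ^ 2 * (2 * N + 9) * (2 * N + 11)) := by
        field_simp
        ring
      have h0 : 0 ≤ (2 * (N : ℝ) + 12) / (2 * ((N : ℝ) + 5) ^ 2 * (2 * N + 9) * (2 * N + 11)) := by
        positivity
      linarith
    have e3 : (0 : ℝ) ≤ 1 - 1 / (2 * ((N : ℝ) + 4) + 1) := by
      rw [sub_nonneg, div_le_one (by positivity)]
      linarith
    calc _ = (1865 / 1000) * ((1 + (2 * (2 * ((N : ℝ) + 1 + 4) + 1) - 1) /
        ((2 * ((N : ℝ) + 1 + 4) + 1) * (2 * ((N : ℝ) + 1 + 4) + 1 - 1) ^ 2)) *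
          (1 - 1 / (2 * ((N : ℝ) + 4) + 1))) := by ring
      _ ≤ (1865 / 1000) * ((1 + 1 / (2 * ((N : ℝ) + 5) ^ 2)) *
          (1 - 1 / (2 * ((N : ℝ) + 4) + 1))) := by
        gcongr
      _ ≤ _ := by gcongr

theorem prod_oddPrimesUpTo_le (z : ℕ) :
    ∏ p ∈ oddPrimesUpTo z, (1 + (2 * p - 1) / ((p : ℝ) * (p - 1) ^ 2)) ≤ 1865 / 1000 := by
  have hsub : oddPrimesUpTo z ⊆ oddPrimesUpTo (2 * (z + 4) + 1) :=
    Finset.filter_subset_filter _ (Finset.range_mono (by omega))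
  have hfac : ∀ p ∈ oddPrimesUpTo (2 * (z + 4) + 1),
      (1 : ℝ) ≤ 1 + (2 * p - 1) / ((p : ℝ) * (p - 1) ^ 2) := by
    intro p hp
    have : (2 : ℝ) ≤ p := by exact_mod_cast (prime_of_mem_oddPrimesUpTo hp).1.two_le
    have : 0 ≤ (2 * (p : ℝ) - 1) / ((p : ℝ) * (p - 1) ^ 2) :=
      div_nonneg (by linarith) (by positivity)
    linarith
  refine (Finset.prod_le_prod_of_subset_of_one_le hsub
    (fun p hp => zero_le_one.trans (hfac p (hsub hp))) fun p hp _ => hfac p hp).trans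
    ((prod_oddPrimesUpTo_odd_le z).trans ?_)
  have : 0 ≤ 1 / (2 * ((z : ℝ) + 4) + 1) := by positivity
  linarith

/-- Only the primes up to `z` need averaging: `s` has at most `log₂ n` larger prime factors, whose
total effect is at most `(z + log₂ n) / z`. -/
theorem oddRatio_sq_le {s n z : ℕ} (hs : s ≠ 0) (hsn : s ≤ n) (hz : 0 < z) :
    oddRatio s ^ 2 ≤ (((z : ℝ) + Nat.log 2 n) / z) ^ 2 *
      ∏ p ∈ oddPrimesUpTo z with p ∣ s, ((p : ℝ) / (p - 1)) ^ 2 := by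
  have hzR : (0 : ℝ) < z := by exact_mod_cast hz
  have hsmall : (oddPrimeFactors s).filter (fun p => ¬ z < p)
      = (oddPrimesUpTo z).filter fun p => p ∣ s := by
    ext p
    simp only [oddPrimeFactors, oddPrimesUpTo, Finset.mem_filter, Finset.mem_erase,
      Nat.mem_primeFactors, Finset.mem_range]
    constructor
    · rintro ⟨⟨h1, h2, h3, _⟩, h5⟩
      exact ⟨⟨by omega, h2, h1⟩, h3⟩
    · rintro ⟨⟨h1, h2, h3⟩, h4⟩
      exact ⟨⟨h3, h2, h4, hs⟩, by omega⟩
  have hlarge := prod_div_sub_one_le hz ((oddPrimeFactors s).filter fun p => z < p)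
    fun p hp => (Finset.mem_filter.1 hp).2
  have hc : (((oddPrimeFactors s).filter fun p => z < p).card : ℝ) ≤ Nat.log 2 n := by
    exact_mod_cast (Finset.card_le_card (Finset.filter_subset _ _)).trans
      (card_oddPrimeFactors_le_log hs hsn)
  have hlarge' : ∏ p ∈ oddPrimeFactors s with z < p, ((p : ℝ) / (p - 1))
      ≤ ((z : ℝ) + Nat.log 2 n) / z := hlarge.trans (by gcongr)
  have hnn : ∀ Q ⊆ oddPrimeFactors s, 0 ≤ ∏ p ∈ Q, ((p : ℝ) / (p - 1)) := fun Q hQ =>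
    Finset.prod_nonneg fun p hp =>
      zero_le_one.trans (one_le_div_sub_one (prime_of_mem_oddPrimeFactors (hQ hp)).1.two_le)
  have hsplit : oddRatio s = (∏ p ∈ oddPrimeFactors s with z < p, ((p : ℝ) / (p - 1))) *
      ∏ p ∈ oddPrimesUpTo z with p ∣ s, ((p : ℝ) / (p - 1)) := by
    rw [← hsmall, Finset.prod_filter_mul_prod_filter_not]
    rfl
  rw [Finset.prod_pow, ← mul_pow, hsplit]
  have h1 := hnn _ (Finset.filter_subset (fun p => z < p) _)
  have h2 := hnn _ (Finset.filter_subset (fun p => ¬ z < p) _)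
  rw [hsmall] at h2
  exact pow_le_pow_left₀ (mul_nonneg h1 h2) (mul_le_mul_of_nonneg_right hlarge' h2) 2

theorem sum_oddRatio_sq_le {c m n z : ℕ} (hc : 0 < c) (hn : ∀ i < m, c + 2 * i ≤ n) (hz : 0 < z) :
    ∑ i ∈ Finset.range m, oddRatio (c + 2 * i) ^ 2 ≤
      (((z : ℝ) + Nat.log 2 n) / z) ^ 2 * (1865 / 1000 * m + ((z : ℝ) + 2) ^ 2) := by
  have hcard : (oddPrimesUpTo z).card ≤ z + 1 := by
    have := Finset.card_filter_le (Finset.range (z + 1)) fun p => p.Prime ∧ p ≠ 2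
    rwa [Finset.card_range] at this
  have hcardR : ((oddPrimesUpTo z).card : ℝ) ≤ z + 1 := by exact_mod_cast hcard
  have hprod : ∏ p ∈ oddPrimesUpTo z, ((p : ℝ) / (p - 1)) ≤ (z : ℝ) + 2 := by
    have h := prod_div_sub_one_le one_pos (oddPrimesUpTo z)
      fun p hp => (prime_of_mem_oddPrimesUpTo hp).1.one_lt
    push_cast at h
    rw [div_one] at h
    linarith
  have hprod0 : 0 ≤ ∏ p ∈ oddPrimesUpTo z, ((p : ℝ) / (p - 1)) :=
    Finset.prod_nonneg fun p hp =>
      zero_le_one.trans (one_le_div_sub_one (prime_of_mem_oddPrimesUpTo hp).1.two_le)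
  calc ∑ i ∈ Finset.range m, oddRatio (c + 2 * i) ^ 2
      ≤ ∑ i ∈ Finset.range m, (((z : ℝ) + Nat.log 2 n) / z) ^ 2 *
          ∏ p ∈ oddPrimesUpTo z with p ∣ c + 2 * i, ((p : ℝ) / (p - 1)) ^ 2 :=
        Finset.sum_le_sum fun i hi =>
          oddRatio_sq_le (by omega) (hn i (Finset.mem_range.1 hi)) hz
    _ ≤ _ := by
        rw [← Finset.mul_sum]
        refine mul_le_mul_of_nonneg_left ((sum_prod_dvd_sq_le c m z).trans ?_) (sq_nonneg _)
        rw [Finset.prod_pow]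
        have := mul_le_mul_of_nonneg_left (prod_oddPrimesUpTo_le z) (Nat.cast_nonneg (α := ℝ) m)
        have := pow_le_pow_left₀ hprod0 hprod 2
        linarith

/-! ### Hall's inequality -/

/-- If `s` is compatible with no term indexed by `T`, then the complement of `T` is so large that
it accommodates almost the expected number of terms compatible with `s`. -/
theorem le_oddRatio_mul_sub_card {c m n k s : ℕ} {T : Finset ℕ} (hs : s ≠ 0) (hsn : s ≤ n)
    (hk : Odd k) (hkn : 1000 * (Nat.log 2 n + 1) ^ 3 ≤ 2 ^ (k + 1))
    (hmn : 1000 * (Nat.log 2 n + 1) ^ (k + 1) ≤ m) (hT : T ⊆ Finset.range m)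
    (hsT : ∀ j ∈ T, ∃ p ∈ oddPrimeFactors s, p ∣ c + 2 * j) :
    998 / 1000 * (m : ℝ) ≤ oddRatio s * ((m : ℝ) - T.card) := by
  have hsieve := le_card_filter_forall_not_dvd
    (fun p hp => prime_of_mem_oddPrimeFactors (s := s) hp) c m hk
  rw [prod_one_sub_inv_eq] at hsieve
  change (m : ℝ) * (1 / oddRatio s - oddRatio s ^ 2 / 2 ^ (k + 1)) - _ ≤ _ at hsieve
  have hH1 := one_le_oddRatio s
  have hHw := oddRatio_le hs hsn
  set H := oddRatio s with hH
  have hw : ((oddPrimeFactors s).card : ℝ) ≤ Nat.log 2 n := by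
    exact_mod_cast card_oddPrimeFactors_le_log hs hsn
  set w : ℝ := (Nat.log 2 n : ℝ) with hwdef
  have hw0 : 0 ≤ w := Nat.cast_nonneg _
  have hkn' : 1000 * (w + 1) ^ 3 ≤ (2 : ℝ) ^ (k + 1) := by
    rw [hwdef]
    exact_mod_cast hkn
  have hmn' : 1000 * (w + 1) ^ (k + 1) ≤ (m : ℝ) := by
    rw [hwdef]
    exact_mod_cast hmn
  have hcount : (((Finset.range m).filter fun i => ∀ p ∈ oddPrimeFactors s, ¬ p ∣ c + 2 * i).card
      : ℝ) ≤ (m : ℝ) - T.card := by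
    have hsub : (Finset.range m).filter (fun i => ∀ p ∈ oddPrimeFactors s, ¬ p ∣ c + 2 * i)
        ⊆ Finset.range m \ T := by
      intro i hi
      rw [Finset.mem_filter] at hi
      refine Finset.mem_sdiff.2 ⟨hi.1, fun hiT => ?_⟩
      obtain ⟨p, hp, hpd⟩ := hsT i hiT
      exact hi.2 p hp hpd
    have h := Finset.card_le_card hsub
    have h2 := Finset.card_sdiff_add_card_eq_card hT
    rw [Finset.card_range] at h2
    have h3 : (((Finset.range m \ T).card : ℕ) : ℝ) + T.card = m := by exact_mod_cast h2
    have h4 : (((Finset.range m).filter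
      fun i => ∀ p ∈ oddPrimeFactors s, ¬ p ∣ c + 2 * i).card : ℝ) ≤
        ((Finset.range m \ T).card : ℕ) := by exact_mod_cast h
    linarith
  have hpow : (((oddPrimeFactors s).card : ℝ) + 1) ^ k ≤ (w + 1) ^ k :=
    pow_le_pow_left₀ (by positivity) (by linarith) k
  have hH0 : 0 < H := by linarith
  -- The tail and the rounding errors of the sieve, multiplied by `H`, each cost at most `m / 1000`;
  -- hence 998.
  have h1 : H ^ 3 / 2 ^ (k + 1) ≤ 1 / 1000 := by
    rw [div_le_div_iff₀ (by positivity) (by norm_num)]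
    have : H ^ 3 ≤ (w + 1) ^ 3 := pow_le_pow_left₀ hH0.le hHw 3
    linarith
  have h2 : H * (w + 1) ^ k ≤ 1 / 1000 * m := by
    have : H * (w + 1) ^ k ≤ (w + 1) * (w + 1) ^ k :=
      mul_le_mul_of_nonneg_right hHw (by positivity)
    rw [pow_succ'] at hmn'
    linarith
  have h3 : H * ((m : ℝ) * (1 / H - H ^ 2 / 2 ^ (k + 1)) - (w + 1) ^ k)
      = m - m * (H ^ 3 / 2 ^ (k + 1)) - H * (w + 1) ^ k := by
    field_simp
  have h4 : H * ((m : ℝ) * (1 / H - H ^ 2 / 2 ^ (k + 1)) - (w + 1) ^ k) ≤ H * (m - T.card) :=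
    mul_le_mul_of_nonneg_left (by linarith) hH0.le
  have h5 := mul_le_mul_of_nonneg_left h1 (Nat.cast_nonneg (α := ℝ) m)
  linarith

/-- Two families of terms without compatible pairs, the second of which fills at least half of its
progression, satisfy Hall's inequality. -/
theorem card_add_card_le_of_half_le {c c' m n k : ℕ} {S T : Finset ℕ} (hc : 0 < c) (hn : 2 ≤ n)
    (hcn : ∀ i < m, c + 2 * i ≤ n) (hk : Odd k)
    (hkn : 1000 * (Nat.log 2 n + 1) ^ 3 ≤ 2 ^ (k + 1))
    (hmn : 1000 * (Nat.log 2 n + 1) ^ (k + 1) ≤ m)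
    (hmn2 : 10 ^ 8 * (Nat.log 2 n + 1) ^ 2 ≤ m)
    (hS : S ⊆ Finset.range m) (hT : T ⊆ Finset.range m) (hTm : m ≤ 2 * T.card)
    (hST : ∀ i ∈ S, ∀ j ∈ T, ∃ p : ℕ, p.Prime ∧ p ≠ 2 ∧ p ∣ c + 2 * i ∧ p ∣ c' + 2 * j) :
    S.card + T.card ≤ m := by
  by_contra! hlt
  have hw1 : 1 ≤ Nat.log 2 n := Nat.log_pos (by norm_num) hn
  have hTle := Finset.card_le_card hT
  rw [Finset.card_range] at hTle
  set w : ℕ := Nat.log 2 n with hw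
  set u : ℝ := (m : ℝ) - T.card with hu
  have hu0 : 0 ≤ u := by
    rw [hu, sub_nonneg]
    exact_mod_cast hTle
  have hSu : u < S.card := by
    have : (m : ℝ) < S.card + T.card := by exact_mod_cast hlt
    linarith
  have hum : 2 * u ≤ m := by
    have : (m : ℝ) ≤ 2 * T.card := by exact_mod_cast hTm
    linarith
  have hm0 : (0 : ℝ) < m := by
    have : 0 < m := lt_of_lt_of_le (by positivity) hmn2
    exact_mod_cast this
  have hpt : ∀ i ∈ S, 998 / 1000 * (m : ℝ) ≤ oddRatio (c + 2 * i) * u := by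
    intro i hi
    refine le_oddRatio_mul_sub_card (c := c') (by omega)
      (hcn i (Finset.mem_range.1 (hS hi))) hk hkn hmn hT fun j hj => ?_
    obtain ⟨p, hp, hp2, hpi, hpj⟩ := hST i hi j hj
    exact ⟨p, Finset.mem_erase.2 ⟨hp2, Nat.mem_primeFactors.2 ⟨hp, hpi, by omega⟩⟩, hpj⟩
  have hupos : 0 < u := by
    rcases hu0.eq_or_lt with h | h
    · obtain ⟨i, hi⟩ : S.Nonempty := by
        rw [← Finset.card_pos]
        have : (0 : ℝ) < S.card := by linarith
        exact_mod_cast this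
      have := hpt i hi
      rw [← h] at this
      linarith
    · exact h
  -- The cut at `1000 * w` limits the effect of large primes to the factor 1.001.
  have hmoment := sum_oddRatio_sq_le hc hcn (z := 1000 * w) (by omega)
  have hwR : (1 : ℝ) ≤ w := by exact_mod_cast hw1
  have hratio : (((1000 * w : ℕ) : ℝ) + Nat.log 2 n) / ((1000 * w : ℕ) : ℝ) = 1001 / 1000 := by
    rw [← hw]
    push_cast
    field_simp
    norm_num
  have hz : (((1000 * w : ℕ) : ℝ) + 2) ^ 2 ≤ 1 / 100 * m := by
    have h : (10 : ℝ) ^ 8 * ((w : ℝ) + 1) ^ 2 ≤ m := by exact_mod_cast hmn2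
    push_cast
    nlinarith
  have hsum : (S.card : ℝ) * (998 / 1000 * (m : ℝ)) ^ 2 ≤
      u ^ 2 * ∑ i ∈ Finset.range m, oddRatio (c + 2 * i) ^ 2 := by
    calc (S.card : ℝ) * (998 / 1000 * (m : ℝ)) ^ 2
        = ∑ _i ∈ S, (998 / 1000 * (m : ℝ)) ^ 2 := by rw [Finset.sum_const, nsmul_eq_mul]
      _ ≤ ∑ i ∈ S, u ^ 2 * oddRatio (c + 2 * i) ^ 2 := by
          refine Finset.sum_le_sum fun i hi => ?_
          rw [← mul_pow, mul_comm u]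
          exact pow_le_pow_left₀ (by positivity) (hpt i hi) 2
      _ ≤ ∑ i ∈ Finset.range m, u ^ 2 * oddRatio (c + 2 * i) ^ 2 :=
          Finset.sum_le_sum_of_subset_of_nonneg hS fun i _ _ => by positivity
      _ = _ := by rw [Finset.mul_sum]
  rw [hratio] at hmoment
  -- `1.001 ^ 2 * (1.865 + 0.01) < 1.88`.
  have hmoment' : ∑ i ∈ Finset.range m, oddRatio (c + 2 * i) ^ 2 ≤ 188 / 100 * m := by
    refine hmoment.trans ?_
    linarith
  have h1 : u * (998 / 1000 * (m : ℝ)) ^ 2 ≤ (S.card : ℝ) * (998 / 1000 * (m : ℝ)) ^ 2 :=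
    mul_le_mul_of_nonneg_right hSu.le (sq_nonneg _)
  have h2 : u ^ 2 * ∑ i ∈ Finset.range m, oddRatio (c + 2 * i) ^ 2 ≤
      u ^ 2 * (188 / 100 * m) := mul_le_mul_of_nonneg_left hmoment' (sq_nonneg u)
  have h3 : u ^ 2 * (188 / 100 * (m : ℝ)) ≤ u * (m / 2) * (188 / 100 * m) := by
    refine mul_le_mul_of_nonneg_right ?_ (by positivity)
    rw [sq]
    exact mul_le_mul_of_nonneg_left (by linarith) hu0
  have h4 : 0 < u * (m : ℝ) ^ 2 := by positivity
  -- The chain gives `0.998 ^ 2 * u * m ^ 2 ≤ 0.94 * u * m ^ 2`, impossible for `u, m > 0`.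
  nlinarith

/-! ### Coprime matchings -/

/-- Terms of two progressions of difference two and opposite parity can be matched coprimely. -/
theorem exists_coprime_matching {c c' m n k : ℕ} (hc : 0 < c) (hc' : 0 < c') (hn : 2 ≤ n)
    (hcn : ∀ i < m, c + 2 * i ≤ n) (hcn' : ∀ i < m, c' + 2 * i ≤ n) (hpar : Odd (c + c'))
    (hk : Odd k) (hkn : 1000 * (Nat.log 2 n + 1) ^ 3 ≤ 2 ^ (k + 1))
    (hmn : 1000 * (Nat.log 2 n + 1) ^ (k + 1) ≤ m)
    (hmn2 : 10 ^ 8 * (Nat.log 2 n + 1) ^ 2 ≤ m) :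
    ∃ σ : ℕ → ℕ, (∀ i < m, σ i < m) ∧ (∀ i < m, ∀ j < m, σ i = σ j → i = j) ∧
      ∀ i < m, Nat.Coprime (c + 2 * i) (c' + 2 * σ i) := by
  classical
  have hall : ∀ S : Finset (Fin m), S.card ≤
      (Finset.univ.filter fun j : Fin m =>
        ∃ i ∈ S, Nat.Coprime (c + 2 * (i : ℕ)) (c' + 2 * (j : ℕ))).card := by
    intro S
    set N := Finset.univ.filter fun j : Fin m =>
      ∃ i ∈ S, Nat.Coprime (c + 2 * (i : ℕ)) (c' + 2 * (j : ℕ)) with hN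
    set S' := S.map Fin.valEmbedding with hS'
    set T' := Nᶜ.map Fin.valEmbedding with hT'
    have hsub : ∀ R : Finset (Fin m), R.map Fin.valEmbedding ⊆ Finset.range m := by
      intro R x hx
      obtain ⟨i, _, rfl⟩ := Finset.mem_map.1 hx
      exact Finset.mem_range.2 i.2
    have hST : ∀ i ∈ S', ∀ j ∈ T',
        ∃ p : ℕ, p.Prime ∧ p ≠ 2 ∧ p ∣ c + 2 * i ∧ p ∣ c' + 2 * j := by
      intro i hi j hj
      obtain ⟨i, hiS, rfl⟩ := Finset.mem_map.1 hi
      obtain ⟨j, hjN, rfl⟩ := Finset.mem_map.1 hj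
      rw [Finset.mem_compl, hN, Finset.mem_filter] at hjN
      have hnc : ¬ Nat.Coprime (c + 2 * (i : ℕ)) (c' + 2 * (j : ℕ)) := fun h =>
        hjN ⟨Finset.mem_univ _, i, hiS, h⟩
      obtain ⟨p, hp, h1, h2⟩ := Nat.Prime.not_coprime_iff_dvd.1 hnc
      refine ⟨p, hp, ?_, h1, h2⟩
      rintro rfl
      -- The two terms have odd sum, so 2 cannot divide both.
      have h3 := dvd_add h1 h2
      rw [Nat.odd_iff] at hpar
      omega
    have hcard : S'.card + T'.card ≤ m := by
      rcases le_total m (2 * T'.card) with h | h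
      · exact card_add_card_le_of_half_le hc hn hcn hk hkn hmn hmn2 (hsub _) (hsub _) h hST
      -- Here `T'` fills at most half, so a violation forces `S'` to fill at least half, and the
      -- roles swap.
      · by_contra! hlt
        have := card_add_card_le_of_half_le (S := T') (T := S') hc' hn hcn' hk hkn hmn hmn2
          (hsub _) (hsub _) (by omega) fun j hj i hi => by
            obtain ⟨p, h1, h2, h3, h4⟩ := hST i hi j hj
            exact ⟨p, h1, h2, h4, h3⟩
        omega
    rw [hS', hT', Finset.card_map, Finset.card_map, Finset.card_compl, Fintype.card_fin] at hcard
    have : N.card ≤ m := by simpa using Finset.card_le_univ N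
    omega
  obtain ⟨f, hf, hfc⟩ := (Fintype.all_card_le_filter_rel_iff_exists_injective
    fun i j : Fin m => Nat.Coprime (c + 2 * (i : ℕ)) (c' + 2 * (j : ℕ))).1 fun S => by convert hall S
  refine ⟨fun i => if h : i < m then f ⟨i, h⟩ else 0, fun i hi => ?_, fun i hi j hj hij => ?_,
    fun i hi => ?_⟩
  · simp only [hi, dif_pos]
    exact (f ⟨i, hi⟩).2
  · simp only [hi, hj, dif_pos] at hij
    exact congrArg Fin.val (hf (Fin.ext hij))
  · simp only [hi, dif_pos]
    exact hfc ⟨i, hi⟩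

theorem exists_isCoprimeMapping_Icc {a b m n k : ℕ} (ha : 0 < a) (hb : 0 < b) (hn : 2 ≤ n)
    (han : a + 2 * m ≤ n + 1) (hbn : b + 2 * m ≤ n + 1)
    (hk : Odd k) (hkn : 1000 * (Nat.log 2 n + 1) ^ 3 ≤ 2 ^ (k + 1))
    (hmn : 1000 * (Nat.log 2 n + 1) ^ (k + 1) ≤ m)
    (hmn2 : 10 ^ 8 * (Nat.log 2 n + 1) ^ 2 ≤ m) :
    ∃ φ : ℕ → ℕ, IsCoprimeMapping (Finset.Ico a (a + 2 * m)) (Finset.Ico b (b + 2 * m)) φ := by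
  -- `b + e` starts the class of the second interval whose parity is opposite to `a`; `b + (1 - e)`
  -- starts the other.
  obtain ⟨e, he, hpar⟩ : ∃ e ≤ 1, Odd (a + (b + e)) := by
    rcases Nat.even_or_odd (a + b) with h | h
    · exact ⟨1, le_rfl, by rw [← add_assoc]; exact h.add_one⟩
    · exact ⟨0, zero_le_one, by simpa using h⟩
  have hpar' : Odd (a + 1 + (b + (1 - e))) := by
    rw [Nat.odd_iff] at hpar ⊢
    omega
  obtain ⟨σ, hσm, hσi, hσc⟩ := exists_coprime_matching (c := a) (c' := b + e) (m := m) (n := n)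
    ha (by omega) hn (fun i hi => by omega) (fun i hi => by omega) hpar hk hkn hmn hmn2
  obtain ⟨τ, hτm, hτi, hτc⟩ := exists_coprime_matching (c := a + 1) (c' := b + (1 - e)) (m := m)
    (n := n) (by omega) (by omega) hn (fun i hi => by omega) (fun i hi => by omega) hpar'
    hk hkn hmn hmn2
  set φ : ℕ → ℕ := fun x =>
    if (x - a) % 2 = 0 then b + e + 2 * σ ((x - a) / 2) else b + (1 - e) + 2 * τ ((x - a) / 2)
    with hφ
  have hrep : ∀ x ∈ Finset.Ico a (a + 2 * m), (∃ i < m, x = a + 2 * i ∧ φ x = b + e + 2 * σ i) ∨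
      ∃ i < m, x = a + 1 + 2 * i ∧ φ x = b + (1 - e) + 2 * τ i := by
    intro x hx
    rw [Finset.mem_Ico] at hx
    by_cases h : (x - a) % 2 = 0
    · exact Or.inl ⟨(x - a) / 2, by omega, by omega, by simp only [hφ, h, if_true]⟩
    · exact Or.inr ⟨(x - a) / 2, by omega, by omega, by simp only [hφ, h, if_false]⟩
  have hmaps : ∀ x ∈ Finset.Ico a (a + 2 * m), φ x ∈ Finset.Ico b (b + 2 * m) := by
    intro x hx
    rw [Finset.mem_Ico]
    rcases hrep x hx with ⟨i, hi, _, h⟩ | ⟨i, hi, _, h⟩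
    · have := hσm i hi
      omega
    · have := hτm i hi
      omega
  have hinj : Set.InjOn φ (Finset.Ico a (a + 2 * m) : Finset ℕ) := by
    intro x hx y hy hxy
    rcases hrep x hx with ⟨i, hi, hxi, h⟩ | ⟨i, hi, hxi, h⟩ <;>
      rcases hrep y hy with ⟨j, hj, hyj, h'⟩ | ⟨j, hj, hyj, h'⟩
    · have := hσi i hi j hj (by omega)
      omega
    · omega
    · omega
    · have := hτi i hi j hj (by omega)
      omega
  refine ⟨φ, ⟨hmaps, hinj, ?_⟩, fun x hx => ?_⟩
  · exact Finset.surjOn_of_injOn_of_card_le φ hmaps hinj (by simp)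
  · rcases hrep x hx with ⟨i, hi, hxi, h⟩ | ⟨i, hi, hxi, h⟩
    · rw [h, hxi]
      exact hσc i hi
    · rw [h, hxi]
      exact hτc i hi

/-! ### Bounds for the threshold -/

theorem coprimeThreshold_le {n k M : ℕ} (hn : 2 ≤ n) (hk : Odd k)
    (hkn : 1000 * (Nat.log 2 n + 1) ^ 3 ≤ 2 ^ (k + 1))
    (hmn : 1000 * (Nat.log 2 n + 1) ^ (k + 1) ≤ M)
    (hmn2 : 10 ^ 8 * (Nat.log 2 n + 1) ^ 2 ≤ M) : coprimeThreshold n ≤ 2 * M := by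
  refine Nat.sInf_le fun m hm A B hA hB hAn hBn hcA hcB => ?_
  -- For `m = 0` the interval is empty and its endpoints are not determined.
  have hm0 : 0 < m := by
    have : 0 < M := lt_of_lt_of_le (by positivity) hmn2
    omega
  have hIco : ∀ I : Finset ℕ, IsIntervalSet I → I ⊆ Finset.Icc 1 n → I.card = 2 * m →
      ∃ a, 0 < a ∧ a + 2 * m ≤ n + 1 ∧ I = Finset.Ico a (a + 2 * m) := by
    rintro _ ⟨a, b, rfl⟩ hsub hcard
    rw [Nat.card_Icc] at hcard
    have h1 := Finset.mem_Icc.1 (hsub (Finset.mem_Icc.2 ⟨le_rfl, by omega⟩ : a ∈ Finset.Icc a b))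
    have h2 := Finset.mem_Icc.1 (hsub (Finset.mem_Icc.2 ⟨by omega, le_rfl⟩ : b ∈ Finset.Icc a b))
    refine ⟨a, by omega, by omega, ?_⟩
    ext x
    rw [Finset.mem_Icc, Finset.mem_Ico]
    omega
  obtain ⟨a, ha, han, rfl⟩ := hIco A hA hAn hcA
  obtain ⟨b, hb, hbn, rfl⟩ := hIco B hB hBn hcB
  exact exists_isCoprimeMapping_Icc ha hb hn han hbn hk hkn (by omega) (by omega)

/-- In `{6, 7}` and `{2, 3}`, 6 has no coprime partner. Positivity makes the logarithm of the
threshold nonnegative and inverted by `exp`. -/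
theorem one_le_coprimeThreshold {n : ℕ} (hn : 7 ≤ n) : 1 ≤ coprimeThreshold n := by
  by_contra! h
  have hleast := (coprimeThreshold_isLeast n).1
  rw [Nat.lt_one_iff.1 h] at hleast
  obtain ⟨φ, hφ, hcop⟩ := hleast 1 (by norm_num) (Finset.Icc 6 7) (Finset.Icc 2 3)
    ⟨_, _, rfl⟩ ⟨_, _, rfl⟩ (Finset.Icc_subset_Icc (by norm_num) (by omega))
    (Finset.Icc_subset_Icc (by norm_num) (by omega)) (by simp) (by simp)
  have h6 : 6 ∈ Finset.Icc 6 7 := by simp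
  have h1 := Finset.mem_Icc.1 (hφ.mapsTo h6)
  have h2 := hcop 6 h6
  obtain ⟨h3, h4⟩ := h1
  interval_cases φ 6 <;> revert h2 <;> decide

theorem coprimeThreshold_le_two_pow {n : ℕ} (hn : 2 ≤ n) :
    coprimeThreshold n ≤ 2 ^ (50 * (Nat.log 2 (Nat.log 2 n + 1) + 1) ^ 2) := by
  set w := Nat.log 2 n with hw
  set v := Nat.log 2 (w + 1) + 1 with hv
  have hwv : w + 1 ≤ 2 ^ v := (Nat.lt_pow_succ_log_self (by norm_num) _).le
  have hv1 : 1 ≤ v := by omega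
  -- Since `w + 1 ≤ 2 ^ v`, the hypotheses reduce to comparing exponents: `10 + 3v ≤ 4v + 12` for
  -- the depth, and `10 + v(4v + 12)` and `27 + 2v` against the exponent of `M`.
  have h := coprimeThreshold_le (n := n) (k := 4 * v + 11) (M := 2 ^ (30 + v * (4 * v + 12))) hn
    ⟨2 * v + 5, by ring⟩ ?_ ?_ ?_
  · refine h.trans ?_
    rw [← pow_succ']
    exact Nat.pow_le_pow_right (by norm_num) (by nlinarith)
  · calc 1000 * (Nat.log 2 n + 1) ^ 3 ≤ 2 ^ 10 * (2 ^ v) ^ 3 := by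
          gcongr
          norm_num
      _ = 2 ^ (10 + v * 3) := by rw [← pow_mul, ← pow_add]
      _ ≤ _ := Nat.pow_le_pow_right (by norm_num) (by omega)
  · calc 1000 * (Nat.log 2 n + 1) ^ (4 * v + 11 + 1) ≤ 2 ^ 10 * (2 ^ v) ^ (4 * v + 12) := by
          gcongr
          norm_num
      _ = 2 ^ (10 + v * (4 * v + 12)) := by rw [← pow_mul, ← pow_add]
      _ ≤ _ := Nat.pow_le_pow_right (by norm_num) (by omega)
  · calc 10 ^ 8 * (Nat.log 2 n + 1) ^ 2 ≤ 2 ^ 27 * (2 ^ v) ^ 2 :=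
          Nat.mul_le_mul (by norm_num) (Nat.pow_le_pow_left hwv 2)
      _ = 2 ^ (27 + v * 2) := by rw [← pow_mul, ← pow_add]
      _ ≤ _ := Nat.pow_le_pow_right (by norm_num) (by nlinarith)

theorem natLog_two_add_one_le_two_mul_log {x : ℝ} {N : ℕ} (hN : 0 < N) (hx : 8 ≤ x)
    (hNx : (N : ℝ) ≤ x) : (Nat.log 2 N : ℝ) + 1 ≤ 2 * Real.log x := by
  have hpow : (2 : ℝ) ^ Nat.log 2 N ≤ N := by
    exact_mod_cast Nat.pow_log_le_self 2 hN.ne'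
  have h1 : (Nat.log 2 N : ℝ) * Real.log 2 ≤ Real.log x := by
    rw [← Real.log_pow]
    exact Real.log_le_log (by positivity) (hpow.trans hNx)
  have h2 := Real.log_two_gt_d9
  have h3 : 3 * Real.log 2 ≤ Real.log x := by
    have : (3 : ℝ) * Real.log 2 = Real.log 8 := by
      rw [show (8 : ℝ) = 2 ^ 3 by norm_num, Real.log_pow]
      norm_num
    rw [this]
    exact Real.log_le_log (by norm_num) hx
  have h4 : (0 : ℝ) ≤ Nat.log 2 N := Nat.cast_nonneg _
  nlinarith

theorem mainTheorem3 :
    ∃ g : ℕ → ℝ,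
      g =O[atTop] (fun n : ℕ => (Real.log (Real.log (n : ℝ))) ^ 2) ∧
      ∀ᶠ n : ℕ in atTop, (coprimeThreshold n : ℝ) = Real.exp (g n) := by
  refine ⟨fun n => Real.log (coprimeThreshold n), ?_, ?_⟩
  · have hlog : Tendsto (fun n : ℕ => Real.log (n : ℝ)) atTop atTop :=
      Real.tendsto_log_atTop.comp tendsto_natCast_atTop_atTop
    have hloglog : Tendsto (fun n : ℕ => Real.log (Real.log (n : ℝ))) atTop atTop :=
      Real.tendsto_log_atTop.comp hlog
    -- `800 = 50 * 4 ^ 2`, from the exponent `50 * v ^ 2` and `v ≤ 4 log log n`.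
    refine IsBigO.of_bound 800 ?_
    filter_upwards [eventually_ge_atTop 8, hlog.eventually_ge_atTop 8,
      hloglog.eventually_ge_atTop 1] with n hn hn1 hn2
    have h1 : (1 : ℝ) ≤ coprimeThreshold n := by
      exact_mod_cast one_le_coprimeThreshold (by omega : 7 ≤ n)
    have hn8 : (8 : ℝ) ≤ n := by exact_mod_cast hn
    have hw := natLog_two_add_one_le_two_mul_log (by omega : 0 < n) hn8 le_rfl
    have hv := natLog_two_add_one_le_two_mul_log (N := Nat.log 2 n + 1)
      (x := 2 * Real.log n) (by omega) (by linarith) (by push_cast; exact hw)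
    rw [Real.log_mul (by norm_num) (by linarith)] at hv
    set v := Nat.log 2 (Nat.log 2 n + 1) + 1 with hvdef
    have hv' : (v : ℝ) ≤ 4 * Real.log (Real.log n) := by
      rw [hvdef]
      push_cast
      linarith [Real.log_two_lt_d9]
    have hle : Real.log (coprimeThreshold n) ≤ 50 * (v : ℝ) ^ 2 := by
      have h2 : (coprimeThreshold n : ℝ) ≤ 2 ^ (50 * v ^ 2) := by
        exact_mod_cast coprimeThreshold_le_two_pow (by omega : 2 ≤ n)
      refine (Real.log_le_log (by linarith) h2).trans ?_
      rw [Real.log_pow]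
      push_cast
      have := Real.log_two_lt_d9
      have : (0 : ℝ) ≤ 50 * (v : ℝ) ^ 2 := by positivity
      nlinarith
    rw [Real.norm_of_nonneg (Real.log_nonneg h1), Real.norm_of_nonneg (sq_nonneg _)]
    have h3 : (v : ℝ) ^ 2 ≤ (4 * Real.log (Real.log n)) ^ 2 :=
      pow_le_pow_left₀ (Nat.cast_nonneg v) hv' 2
    linarith
  · filter_upwards [eventually_ge_atTop 7] with n hn
    have : (1 : ℝ) ≤ coprimeThreshold n := by exact_mod_cast one_le_coprimeThreshold hn
    exact (Real.exp_log (by linarith)).symm
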